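/- Binary trees are rooted, each vertex having at most one left child and at most one right child. For a non-empty binary tree $B$ let $LV(B)$ and $RV(B)$ be its sets of left children and of right children. A (non-empty) \emph{non-ambiguous tree} (NAT) $T$ is a non-empty binary tree together with bijective labellings $LV(T)\to\{1,\dots,|LV(T)|\}$ and $RV(T)\to\{1,\dots,|RV(T)|\}$ such that whenever $U\neq V$ are both left children (resp. both right children) and $U$ is an ancestor of $V$, the label of $U$ is strictly greater than the label of $V$. Its \emph{geometric size} is $(|LV(T)|+1)\times(|RV(T)|+1)$. Let $LO(T)$ (resp. $RO(T)$) be the number of non-root vertices that are reached from the root by steps to left children only (resp. to right children only). Put $$\mathfrak{N}(x,y;\alpha,\beta)=\sum_{T}\frac{x^{|LV(T)|}\,y^{|RV(T)|}\,\alpha^{LO(T)}\,\beta^{RO(T)}}{|LV(T)|!\,|RV(T)|!},$$ a formal power series in $x,y$, the sum being over all NATs $T$. Let $S_{2,q}(n,k)=\sum_{\pi} q^{m(\pi)}$, where $\pi$ runs over the partitions of $\{1,\dots,n\}$ into $k$ parts and $m(\pi)$ is the number of elements different from $n$ in the part of $\pi$ containing $n$. Let $q^{(n)}=q(q+1)\cdots(q+n-1)$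 be the rising factorial. Let $i$ and $j$ be positive integers, and let $\alpha,\beta$ be elements of a commutative $\mathbb{Q}$-algebra $R$ (for instance, indeterminates: $R=\mathbb{Q}[\alpha,\beta]$). There are finitely many NATs of geometric size $i\times j$, and $$\sum_{T\text{ of geometric size } i\times j}\alpha^{LO(T)}\beta^{RO(T)}=(i-1)!\,(j-1)!\,\bigl[x^{i-1}y^{j-1}\bigr]\,\mathfrak{N}(x,y;\alpha,\beta)=\sum_{p\ge 1}(p-1)!\,(\alpha+\beta)^{(p-1)}\,S_{2,\alpha}(i,p)\,S_{2,\beta}(j,p),$$ where the last sum has only finitely many non-zero terms, since $S_{2,q}(n,p)=0$ for $p>n$. -/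

import Mathlib

open scoped Nat

noncomputable section

namespace NATree

/-- A vertex of a binary tree is encoded by the list of steps leading to it from the root
(`false` is a step to the left child, `true` is a step to the right child); the root is `[]`. -/
def vertices : BinaryTree Unit → Finset (List Bool)
  | .nil => ∅
  | .node _ l r =>
      insert [] ((vertices l).image (List.cons false) ∪ (vertices r).image (List.cons true))

/-- The vertices that are left children: the last step is a step to the left. -/
def leftVertices (B : BinaryTree Unit) : Finset (List Bool) :=
  (vertices B).filter (fun v => v.getLast? = some false)

/-- The vertices that are right children: the last step is a step to the right. -/
def rightVertices (B : BinaryTree Unit) : Finset (List Bool) :=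
  (vertices B).filter (fun v => v.getLast? = some true)

/-- The leftmost branch: the root and everything reached from it by left steps only. -/
def leftmostBranch (B : BinaryTree Unit) : Finset (List Bool) :=
  (vertices B).filter (fun v => ∀ s ∈ v, s = false)

/-- The rightmost branch: the root and everything reached from it by right steps only. -/
def rightmostBranch (B : BinaryTree Unit) : Finset (List Bool) :=
  (vertices B).filter (fun v => ∀ s ∈ v, s = true)

/-- A (non-empty) non-ambiguous tree: a binary tree whose left children are bijectively labelled
by `1, …, |LV|` and whose right children are bijectively labelled by `1, …, |RV|`, such that labels
strictly decrease from a left (resp. right) child to any other left (resp. right) child below it.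
A vertex `U` is an ancestor of `V` when the path of `U` is a prefix of the path of `V`. -/
structure NonAmbiguousTree where
  shape : BinaryTree Unit
  shape_ne_nil : shape ≠ BinaryTree.nil
  leftLabel : leftVertices shape ≃ Finset.Icc 1 (leftVertices shape).card
  rightLabel : rightVertices shape ≃ Finset.Icc 1 (rightVertices shape).card
  leftLabel_lt : ∀ U V : leftVertices shape, U ≠ V → (U : List Bool) <+: (V : List Bool) →
    (leftLabel V : ℕ) < (leftLabel U : ℕ)
  rightLabel_lt : ∀ U V : rightVertices shape, U ≠ V → (U : List Bool) <+: (V : List Bool) →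
    (rightLabel V : ℕ) < (rightLabel U : ℕ)

namespace NonAmbiguousTree

/-- The number of left children. -/
def numLeft (T : NonAmbiguousTree) : ℕ := (leftVertices T.shape).card

/-- The number of right children. -/
def numRight (T : NonAmbiguousTree) : ℕ := (rightVertices T.shape).card

/-- The geometric size `i × j`, as the pair `(i, j)`. -/
def geomSize (T : NonAmbiguousTree) : ℕ × ℕ := (T.numLeft + 1, T.numRight + 1)

/-- The number of non-root vertices of the leftmost branch. -/
def LO (T : NonAmbiguousTree) : ℕ := ((leftmostBranch T.shape).erase []).card

/-- The number of non-root vertices of the rightmost branch. -/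
def RO (T : NonAmbiguousTree) : ℕ := ((rightmostBranch T.shape).erase []).card

end NonAmbiguousTree

/-- The sum of `α ^ LO T * β ^ RO T` over all non-ambiguous trees `T` of geometric size `i × j`. -/
def weightedCount {R : Type*} [CommRing R] (α β : R) (i j : ℕ) : R :=
  ∑ᶠ (T : NonAmbiguousTree) (_ : T.geomSize = (i, j)), α ^ T.LO * β ^ T.RO

/-- The exponent of the monomial `x ^ a * y ^ b`, where `x` and `y` are the variables of index
`0` and `1`. -/
def xyExp (a b : ℕ) : Fin 2 →₀ ℕ := Finsupp.single 0 a + Finsupp.single 1 b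

/-- The term of a non-ambiguous tree in the generating function,
`x ^ |LV| * y ^ |RV| * α ^ LO * β ^ RO / (|LV|! * |RV|!)`. -/
def gfTerm {R : Type*} [CommRing R] [Algebra ℚ R] (α β : R) (T : NonAmbiguousTree) :
    MvPowerSeries (Fin 2) R :=
  MvPowerSeries.monomial (xyExp T.numLeft T.numRight)
    (((T.numLeft ! * T.numRight ! : ℚ)⁻¹) • (α ^ T.LO * β ^ T.RO))

/-- The generating function `∑_T gfTerm T`, a formal power series in `x` and `y`; the infinite sum
of formal power series is taken coefficient by coefficient. -/
def gf {R : Type*} [CommRing R] [Algebra ℚ R] (α β : R) : MvPowerSeries (Fin 2) R :=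
  fun e => ∑ᶠ T : NonAmbiguousTree, MvPowerSeries.coeff e (gfTerm α β T)

/-- The `q`-Stirling number of the second kind: the sum over the partitions of `{1, …, n}` into `k`
parts of `q` to the number of elements different from `n` in the part containing `n`. -/
def qStirling {R : Type*} [CommRing R] (q : R) (n k : ℕ) : R :=
  ∑ P : Finpartition (Finset.Icc 1 n) with P.parts.card = k, q ^ ((P.part n).erase n).card

/-- Only finitely many `p` contribute to a sum over `p` of multiples of `qStirling q n p`. -/
theorem qStirling_eq_zero_of_lt {R : Type*} [CommRing R] (q : R) {n k : ℕ} (h : n < k) :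
    qStirling q n k = 0 := by
  unfold qStirling
  refine Finset.sum_eq_zero fun P hP => ?_
  have h1 := P.card_parts_le_card
  have h2 := (Finset.mem_filter.1 hP).2
  simp only [Nat.card_Icc] at h1
  omega

/-- The rising factorial `q (q + 1) ⋯ (q + n - 1)`. -/
def risingFactorial {R : Type*} [CommRing R] (q : R) (n : ℕ) : R :=
  (ascPochhammer R n).eval q

end NATree

end

/-! Write F_{a,b} = e^(ax+by) (1 - (e^x - 1)(e^y - 1))^(-a-b). Its binomial expansion has terms
(a+b)^(p)/p! · e^(ax)(e^x - 1)^p · e^(by)(e^y - 1)^p, and m! [x^m] e^(qx)(e^x - 1)^p = p!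
S_{2,q}(m+1, p+1) (`factorial_mul_qStirling`). So the theorem says that the generating function
N_{α,β} of the trees is F_{α,β}.

Cutting a tree at its root gives N_{α,β} = L_α R_β, where L_α and R_β are the series of the possibly
empty left and right subtrees (`sum_shapes`). Interleaving the labels of the two subtrees is a
binomial choice, which the division by factorials absorbs. The root of a non-empty left subtree is
itself a left child and must carry the largest left label of that subtree, so removing it gives ∂_x
L_α = α N_{α,1}, with L_α(0,y) = 1 (`succ_mul_sum_leftSubtrees_succ`). The second parameter becomes
1 because the right branch of the left subtree does not lie on the rightmost branch of the whole
tree. The right side is symmetric.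

The series F obeys the same rules: F_{a,b} = F_{a,0} F_{0,b} (`solCoeff_eq_sum_antidiagonal`), ∂_x
F_{a,0} = a F_{a,1} (`succ_mul_solCoeff_succ`) and F_{a,0}(0,y) = 1. Since these rules determine all
coefficients by induction on the total degree, N = F (`sum_shapes_eq_solCoeff`). The identities for
F are proved coefficientwise. -/

noncomputable section

namespace NATree

open Finset PowerSeries

/-! ### Set partitions and q-Stirling numbers -/

section Stirling

variable {ι : Type*} [DecidableEq ι]

/-- A partition of `insert a s` amounts to a subset `t` of `s`, which with `a` makes the part of
`a`, and a partition of `s \ t`. -/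
theorem sum_finpartition_insert {M : Type*} [AddCommMonoid M] {s : Finset ι} {a : ι} (ha : a ∉ s)
    (g : Finpartition (insert a s) → M) (f : (t : Finset ι) → Finpartition (s \ t) → M)
    (h : ∀ t ⊆ s, ∀ (P : Finpartition (s \ t)) (Q : Finpartition (insert a s)),
      Q.parts = insert (insert a t) P.parts → g Q = f t P) :
    ∑ Q, g Q = ∑ t ∈ s.powerset, ∑ P, f t P := by
  have hdisj : ∀ t : Finset ι, Disjoint (s \ t) (insert a t) := fun t => by
    rw [disjoint_insert_right]
    exact ⟨fun h => ha (mem_sdiff.1 h).1, sdiff_disjoint⟩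
  have hunion : ∀ t ⊆ s, s \ t ⊔ insert a t = insert a s := fun t ht => by
    rw [sup_eq_union, union_insert, sdiff_union_of_subset ht]
  rw [sum_sigma']
  symm
  refine sum_bij (fun x hx => x.2.extend (b := insert a x.1) (insert_ne_empty _ _)
    (hdisj x.1) (hunion x.1 (mem_powerset.1 (mem_sigma.1 hx).1))) (fun _ _ => mem_univ _) ?_ ?_ ?_
  · rintro ⟨t, P⟩ hx ⟨t', P'⟩ hx' heq
    have hp := congrArg Finpartition.parts heq
    simp only [Finpartition.extend_parts] at hp
    simp only [mem_sigma, mem_powerset, mem_univ, and_true] at hx hx'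
    have nmem : ∀ {t t' : Finset ι} (P : Finpartition (s \ t)), insert a t' ∉ P.parts := by
      intro t t' P hm
      exact ha (mem_sdiff.1 (P.subset hm (mem_insert_self a t'))).1
    -- The part of `Q` containing `a` determines `t`: no part of `P'` contains `a`, so `insert a t`
    -- can only be `insert a t'`.
    have htt : t = t' := by
      have h1 : insert a t ∈ insert (insert a t') P'.parts := hp ▸ mem_insert_self _ _
      rcases mem_insert.1 h1 with h1 | h1
      · have := congrArg (fun u => u.erase a) h1
        simpa [erase_insert (fun h => ha (hx h)), erase_insert (fun h => ha (hx' h))] using this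
      · exact absurd h1 (nmem P')
    subst htt
    have : P = P' := by
      ext1
      have := congrArg (fun u => u.erase (insert a t)) hp
      simpa [erase_insert (nmem P), erase_insert (nmem P')] using this
    rw [this]
  · intro Q _
    have haQ : Q.part a ∈ Q.parts := Q.part_mem.2 (mem_insert_self a s)
    have hmem : a ∈ Q.part a := Q.mem_part_self.2 (mem_insert_self a s)
    have hins : insert a ((Q.part a).erase a) = Q.part a := insert_erase hmem
    have hsub : (Q.part a).erase a ⊆ s := fun x hx => by
      have := Q.part_subset a (mem_of_mem_erase hx)
      exact (mem_insert.1 this).resolve_left (ne_of_mem_erase hx)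
    have hsup : (Q.parts.erase (Q.part a)).sup id = s \ (Q.part a).erase a := by
      ext x
      simp only [mem_sup, mem_erase, id, mem_sdiff]
      constructor
      · rintro ⟨p, ⟨hne, hp⟩, hx⟩
        have hxs := Q.subset hp hx
        have hxa : x ∉ Q.part a := fun h' => hne (Q.eq_of_mem_parts hp haQ hx h')
        refine ⟨(mem_insert.1 hxs).resolve_left ?_, fun h' => hxa h'.2⟩
        rintro rfl
        exact hxa hmem
      · rintro ⟨hxs, hx⟩
        obtain ⟨p, hp, hxp⟩ := Q.exists_mem (mem_insert_of_mem (b := a) hxs)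
        refine ⟨p, ⟨?_, hp⟩, hxp⟩
        rintro rfl
        exact hx ⟨fun h' => ha (h' ▸ hxs), hxp⟩
    refine ⟨⟨(Q.part a).erase a, Q.ofSubset (erase_subset _ _) hsup⟩, ?_, ?_⟩
    · simpa using hsub
    · ext1
      simp only [Finpartition.extend_parts, Finpartition.ofSubset_parts, hins]
      exact insert_erase haQ
  · rintro ⟨t, P⟩ hx
    exact (h t (mem_powerset.1 (mem_sigma.1 hx).1) P _ rfl).symm

variable {R : Type*} [CommRing R]

/-- The other elements `t` of the part of `a` carry all the weight, and what remains is an arbitrary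
partition of `s \ t` into one part fewer. -/
theorem sum_finpartition_insert_pow (q : R) {s : Finset ι} {a : ι} (ha : a ∉ s) (k : ℕ) :
    ∑ Q : Finpartition (insert a s) with #Q.parts = k + 1, q ^ #((Q.part a).erase a) =
      ∑ t ∈ s.powerset, q ^ #t * #{P : Finpartition (s \ t) | #P.parts = k} := by
  rw [sum_filter, sum_finpartition_insert ha _
    (fun t P => if #P.parts = k then q ^ #t else 0)]
  · refine sum_congr rfl fun t _ => ?_
    rw [← sum_filter, sum_const, nsmul_eq_mul, mul_comm]
  · intro t ht P Q hQ
    have hn : insert a t ∉ P.parts := fun hm =>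
      ha (mem_sdiff.1 (P.subset hm (mem_insert_self a t))).1
    have hpart : Q.part a = insert a t :=
      Q.part_eq_of_mem (hQ ▸ mem_insert_self _ _) (mem_insert_self a t)
    rw [hQ, card_insert_of_notMem hn, hpart, erase_insert fun h => ha (ht h)]
    simp

/-! ### Exponential generating functions of set partitions -/

theorem factorial_mul_coeff_succ (f : R⟦X⟧) (m : ℕ) :
    ((m + 1)! : R) * coeff (m + 1) f = m ! * coeff m (d⁄dX R f) := by
  rw [coeff_derivative, Nat.factorial_succ]
  push_cast
  ring

variable [Algebra ℚ R]

/-- The power series `e ^ (q x) * (e ^ x - 1) ^ k`. -/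
def expSeries (q : R) (k : ℕ) : R⟦X⟧ := rescale q (exp R) * (exp R - 1) ^ k

theorem factorial_mul_coeff_expSeries (q : R) (k m : ℕ) :
    (m ! : R) * coeff m (expSeries q k) =
      ∑ j ∈ range (m + 1), (m.choose j : R) * (q ^ j * ((m - j)! * coeff (m - j) (expSeries 0 k))) := by
  have h0 : expSeries (0 : R) k = (exp R - 1) ^ k := by
    simp [expSeries]
  rw [h0, expSeries, coeff_mul, Nat.sum_antidiagonal_eq_sum_range_succ_mk, mul_sum]
  refine sum_congr rfl fun j hj => ?_
  have hj : j ≤ m := Nat.lt_succ_iff.1 (mem_range.1 hj)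
  have h1 : (j ! : R) * algebraMap ℚ R (1 / (j ! : ℚ)) = 1 := by
    rw [← map_natCast (algebraMap ℚ R), ← map_mul, mul_one_div_cancel (by positivity), map_one]
  rw [coeff_rescale, coeff_exp, ← Nat.choose_mul_factorial_mul_factorial hj]
  push_cast
  linear_combination (m.choose j * (m - j)! * q ^ j * coeff (m - j) ((exp R - 1) ^ k) : R) * h1

theorem derivative_expSeries_zero_succ (k : ℕ) :
    d⁄dX R (expSeries 0 (k + 1)) = ((k + 1 : ℕ) : R⟦X⟧) * expSeries (1 : R) k := by
  simp [expSeries, derivative_exp]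
  ring

/-- Grouping the subsets by size turns the sum into a binomial convolution, that is, multiplication
of the exponential generating function by e^(qx). The count of partitions is a hypothesis because
the lemma is needed inside the induction that proves that count. -/
theorem factorial_mul_sum_powerset {s : Finset ι} {k : ℕ} (q : R)
    (ih : ∀ t ⊆ s, (k ! : R) * #{P : Finpartition t | #P.parts = k} =
      (#t)! * coeff #t (expSeries (0 : R) k)) :
    (k ! : R) * ∑ t ∈ s.powerset, q ^ #t * #{P : Finpartition (s \ t) | #P.parts = k} =
      (#s)! * coeff #s (expSeries q k) := by
  rw [factorial_mul_coeff_expSeries, mul_sum]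
  simp_rw [← nsmul_eq_mul (Nat.choose _ _)]
  rw [← sum_powerset_apply_card
    (fun j => q ^ j * ((#s - j)! * coeff (#s - j) (expSeries (0 : R) k)))]
  refine sum_congr rfl fun t ht => ?_
  have := ih (s \ t) sdiff_subset
  rw [card_sdiff_of_subset (mem_powerset.1 ht)] at this
  rw [← this]
  ring

/-- The exponential generating function of the partitions into `k` parts is `(e ^ x - 1) ^ k / k!`. -/
theorem factorial_mul_card_finpartition (s : Finset ι) (k : ℕ) :
    (k ! : R) * #{P : Finpartition s | #P.parts = k} = (#s)! * coeff #s (expSeries (0 : R) k) := by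
  induction k generalizing s with
  | zero =>
    have h0 : expSeries (0 : R) 0 = 1 := by simp [expSeries]
    rw [h0, coeff_one]
    rcases s.eq_empty_or_nonempty with rfl | hs
    · have : ({P : Finpartition (∅ : Finset ι) | #P.parts = 0} : Finset _) = univ := by
        refine filter_true_of_mem fun P _ => ?_
        exact Nat.le_zero.1 P.card_parts_le_card
      rw [this]
      have h1 : #(univ : Finset (Finpartition (∅ : Finset ι))) = 1 :=
        card_eq_one.2 ⟨(default : Finpartition (⊥ : Finset ι)), eq_singleton_iff_unique_mem.2
          ⟨mem_univ _, fun P _ => Subsingleton.elim (α := Finpartition (⊥ : Finset ι)) _ _⟩⟩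
      simp [h1]
    · have : ({P : Finpartition s | #P.parts = 0} : Finset _) = ∅ := by
        refine filter_false_of_mem fun P _ => ?_
        exact (card_pos.2 (P.parts_nonempty hs.ne_empty)).ne'
      rw [this, if_neg (card_pos.2 hs).ne']
      simp
  | succ k ih =>
    rcases s.eq_empty_or_nonempty with rfl | ⟨a, ha⟩
    · have : ({P : Finpartition (∅ : Finset ι) | #P.parts = k + 1} : Finset _) = ∅ := by
        refine filter_false_of_mem fun P _ => ?_
        have := P.card_parts_le_card
        simp only [card_empty] at this
        omega
      rw [this]
      simp [expSeries]
    · obtain ⟨t, hat, rfl⟩ : ∃ t, a ∉ t ∧ insert a t = s :=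
        ⟨s.erase a, notMem_erase a s, insert_erase ha⟩
      -- At `q = 1` the weighted sum is a plain count. Removing the part of `a` then matches d/dx
      -- (e^x - 1)^(k+1) = (k+1) e^x (e^x - 1)^k.
      have key := sum_finpartition_insert_pow (1 : R) hat k
      simp only [one_pow, sum_const, nsmul_eq_mul, mul_one] at key
      rw [key, card_insert_of_notMem hat, factorial_mul_coeff_succ, derivative_expSeries_zero_succ,
        Nat.factorial_succ]
      have h2 := factorial_mul_sum_powerset (s := t) (1 : R) fun t _ => ih t
      simp only [one_pow] at h2
      have h3 : coeff (#t) (((k + 1 : ℕ) : R⟦X⟧) * expSeries (1 : R) k) =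
          ((k + 1 : ℕ) : R) * coeff #t (expSeries (1 : R) k) := by
        rw [← map_natCast (C : R →+* R⟦X⟧), coeff_C_mul]
      rw [h3, Nat.cast_mul]
      linear_combination ((k + 1 : ℕ) : R) * h2

/-- The exponential generating function of the `q`-Stirling numbers. -/
theorem factorial_mul_qStirling (q : R) (m k : ℕ) :
    (k ! : R) * qStirling q (m + 1) (k + 1) = m ! * coeff m (expSeries q k) := by
  have hI : Icc 1 (m + 1) = insert (m + 1) (Icc 1 m) := by
    ext x; simp only [mem_Icc, mem_insert]; omega
  have hn : m + 1 ∉ Icc 1 m := by simp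
  unfold qStirling
  rw [hI, sum_finpartition_insert_pow q hn, factorial_mul_sum_powerset q
    fun t _ => factorial_mul_card_finpartition t k]
  simp

end Stirling
end NATree
end

noncomputable section

namespace NATree

open Finset PowerSeries

/-! ### The closed form and its functional equations -/

section Algebra

theorem risingFactorial_succ {R : Type*} [CommRing R] (q : R) (n : ℕ) :
    risingFactorial q (n + 1) = risingFactorial q n * (q + n) := by
  simp [risingFactorial, ascPochhammer_succ_eval]

theorem risingFactorial_succ' {R : Type*} [CommRing R] (q : R) (n : ℕ) :
    risingFactorial q (n + 1) = q * risingFactorial (q + 1) n := by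
  simp [risingFactorial, ascPochhammer_succ_left]

variable {R : Type*} [CommRing R] [Algebra ℚ R]

/-- The rising factorial of `q` divided by `n!`. -/
def risingCoeff (q : R) (n : ℕ) : R := algebraMap ℚ R (n ! : ℚ)⁻¹ * risingFactorial q n

theorem factorial_mul_algebraMap_inv (n : ℕ) : (n ! : R) * algebraMap ℚ R (n ! : ℚ)⁻¹ = 1 := by
  rw [← map_natCast (algebraMap ℚ R), ← map_mul, mul_inv_cancel₀ (by positivity), map_one]

theorem factorial_mul_risingCoeff (q : R) (n : ℕ) :
    (n ! : R) * risingCoeff q n = risingFactorial q n := by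
  rw [risingCoeff, ← mul_assoc, factorial_mul_algebraMap_inv, one_mul]

theorem factorial_mul_cancel (n : ℕ) {a b : R} (h : (n ! : R) * a = n ! * b) : a = b := by
  have h1 := factorial_mul_algebraMap_inv (R := R) n
  linear_combination algebraMap ℚ R (n ! : ℚ)⁻¹ * h - (a - b) * h1

theorem natCast_succ_mul_cancel (n : ℕ) {a b : R} (h : ((n : R) + 1) * a = (n + 1) * b) : a = b := by
  apply factorial_mul_cancel (n + 1)
  rw [Nat.factorial_succ]
  push_cast
  linear_combination (n ! : R) * h

theorem risingCoeff_zero (q : R) : risingCoeff q 0 = 1 := by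
  simp [risingCoeff, risingFactorial]

theorem succ_mul_risingCoeff_succ (q : R) (n : ℕ) :
    ((n : R) + 1) * risingCoeff q (n + 1) = (q + n) * risingCoeff q n := by
  apply factorial_mul_cancel n
  have h := factorial_mul_risingCoeff q (n + 1)
  rw [Nat.factorial_succ] at h
  push_cast at h
  linear_combination h - (q + n) * factorial_mul_risingCoeff q n + risingFactorial_succ q n

theorem mul_risingCoeff_add_one (q : R) (n : ℕ) :
    q * risingCoeff (q + 1) n = (q + n) * risingCoeff q n := by
  apply factorial_mul_cancel n
  linear_combination q * factorial_mul_risingCoeff (q + 1) n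
    - (q + n) * factorial_mul_risingCoeff q n + risingFactorial_succ q n - risingFactorial_succ' q n

/-- Vandermonde's identity, the coefficient form of (1 - t)^(-a) (1 - t)^(-b) = (1 - t)^(-a-b). In
the induction the factor n + 1 is split along the antidiagonal and each half is lowered by the
recurrence of its own factor. -/
theorem sum_antidiagonal_risingCoeff (a b : R) (n : ℕ) :
    ∑ x ∈ antidiagonal n, risingCoeff a x.1 * risingCoeff b x.2 = risingCoeff (a + b) n := by
  induction n with
  | zero => simp [risingCoeff_zero]
  | succ n ih =>
    apply natCast_succ_mul_cancel n
    rw [succ_mul_risingCoeff_succ, ← ih, mul_sum, mul_sum]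
    have h1 : ∑ x ∈ antidiagonal (n + 1), ((n : R) + 1) * (risingCoeff a x.1 * risingCoeff b x.2) =
        ∑ x ∈ antidiagonal (n + 1), (x.1 : R) * risingCoeff a x.1 * risingCoeff b x.2 +
        ∑ x ∈ antidiagonal (n + 1), risingCoeff a x.1 * (x.2 * risingCoeff b x.2) := by
      rw [← sum_add_distrib]
      refine sum_congr rfl fun x hx => ?_
      have : ((x.1 : R) + x.2) = n + 1 := by exact_mod_cast congrArg (Nat.cast (R := R)) (mem_antidiagonal.1 hx)
      rw [← this]
      ring
    rw [h1, Nat.sum_antidiagonal_succ, Nat.sum_antidiagonal_succ']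
    simp only [Nat.cast_zero, zero_mul, mul_zero, zero_add, Nat.cast_add, Nat.cast_one,
      succ_mul_risingCoeff_succ]
    rw [← sum_add_distrib]
    refine sum_congr rfl fun x hx => ?_
    have : ((x.1 : R) + x.2) = n := by exact_mod_cast congrArg (Nat.cast (R := R)) (mem_antidiagonal.1 hx)
    rw [← this]
    ring

theorem coeff_expSeries_of_lt (q : R) {m p : ℕ} (h : m < p) : coeff m (expSeries q p) = 0 := by
  have h1 : (X : R⟦X⟧) ∣ exp R - 1 := by simp [X_dvd_iff]
  have h2 : (X : R⟦X⟧) ^ p ∣ expSeries q p := Dvd.dvd.mul_left (pow_dvd_pow_of_dvd h1 p) _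
  exact X_pow_dvd_iff.1 h2 m h

theorem coeff_zero_expSeries (q : R) (p : ℕ) :
    coeff 0 (expSeries q p) = if p = 0 then 1 else 0 := by
  split_ifs with h
  · subst h
    simp [expSeries, coeff_rescale]
  · exact coeff_expSeries_of_lt q (Nat.pos_of_ne_zero h)

theorem expSeries_zero_zero : expSeries (0 : R) 0 = 1 := by
  simp [expSeries]

theorem expSeries_mul (a b : R) (k l : ℕ) :
    expSeries a k * expSeries b l = expSeries (a + b) (k + l) := by
  rw [expSeries, expSeries, expSeries, ← exp_mul_exp_eq_exp_add]
  ring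

theorem expSeries_add_one (q : R) (p : ℕ) :
    expSeries (q + 1) p = expSeries q p + expSeries q (p + 1) := by
  rw [expSeries, expSeries, expSeries, ← exp_mul_exp_eq_exp_add, rescale_one, RingHom.id_apply]
  ring

theorem derivative_rescale_exp (q : R) :
    d⁄dX R (rescale q (exp R)) = C q * rescale q (exp R) := by
  ext n
  rw [coeff_derivative, coeff_C_mul, coeff_rescale, coeff_rescale]
  have h := congrArg (coeff n) (derivative_exp R)
  rw [coeff_derivative] at h
  rw [← h]
  ring

/-- Differentiation produces e^x, rewritten as (e^x - 1) + 1. The truncated `p - 1` at `p = 0` is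
harmless because its coefficient is `p`. -/
theorem derivative_expSeries (q : R) (p : ℕ) :
    d⁄dX R (expSeries q p) = C (q + p) * expSeries q p + C (p : R) * expSeries q (p - 1) := by
  rcases p with _ | p
  · simp [expSeries, derivative_rescale_exp]
  · rw [expSeries, Derivation.leibniz, derivative_rescale_exp, derivative_pow, map_sub,
      derivative_exp, derivative_one, expSeries]
    simp
    ring

theorem succ_mul_coeff_succ_expSeries (q : R) (p m : ℕ) :
    ((m : R) + 1) * coeff (m + 1) (expSeries q p) =
      (q + p) * coeff m (expSeries q p) + p * coeff m (expSeries q (p - 1)) := by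
  have h := congrArg (coeff m) (derivative_expSeries q p)
  rw [coeff_derivative, map_add, coeff_C_mul, coeff_C_mul] at h
  rw [← h]
  ring

/-- The coefficient of `x ^ m * y ^ n` in
`e ^ (a x + b y) * (1 - (e ^ x - 1) * (e ^ y - 1)) ^ (- a - b)`. -/
def solCoeff (a b : R) (m n : ℕ) : R :=
  ∑ p ∈ range (m + 1), risingCoeff (a + b) p * coeff m (expSeries a p) * coeff n (expSeries b p)

/-- The term of index p vanishes once p exceeds m or n, since (e^x - 1)^p is divisible by x^p. The
freedom in the cutoff makes the symmetry in the two variables visible and lets sums be aligned. -/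
theorem solCoeff_eq_sum_range (a b : R) {m n N : ℕ} (h : m < N ∨ n < N) :
    solCoeff a b m n =
      ∑ p ∈ range N, risingCoeff (a + b) p * coeff m (expSeries a p) * coeff n (expSeries b p) := by
  have aux : ∀ {k l : ℕ}, min m n < k → k ≤ l →
      ∑ p ∈ range k, risingCoeff (a + b) p * coeff m (expSeries a p) * coeff n (expSeries b p) =
      ∑ p ∈ range l, risingCoeff (a + b) p * coeff m (expSeries a p) * coeff n (expSeries b p) := by
    intro k l hk hl
    refine sum_subset (range_mono hl) fun p _ hp => ?_
    have hp : k ≤ p := by simpa using hp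
    rcases min_lt_iff.1 (hk.trans_le hp) with h | h
    · rw [coeff_expSeries_of_lt a h]; ring
    · rw [coeff_expSeries_of_lt b h]; ring
  rw [solCoeff]
  rcases le_total (m + 1) N with h1 | h1
  · exact aux (by omega) h1
  · exact (aux (by omega) h1).symm

theorem solCoeff_comm (a b : R) (m n : ℕ) : solCoeff a b m n = solCoeff b a n m := by
  rw [solCoeff_eq_sum_range a b (N := m + n + 1) (by omega),
    solCoeff_eq_sum_range b a (N := m + n + 1) (by omega), add_comm a b]
  exact sum_congr rfl fun p _ => by ring

theorem solCoeff_zero_left (a : R) (n : ℕ) : solCoeff a 0 0 n = if n = 0 then 1 else 0 := by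
  simp [solCoeff, risingCoeff_zero, coeff_zero_expSeries, expSeries_zero_zero, coeff_one]

/-- The coefficient form of ∂_x F_{a,0} = a F_{a,1}. Both sides split into two sums: on the left by
differentiating e^(ax)(e^x - 1)^p, on the right by e^y = 1 + (e^y - 1). The second sums agree after
a shift of p by one. -/
theorem succ_mul_solCoeff_succ (a : R) (m n : ℕ) :
    ((m : R) + 1) * solCoeff a 0 (m + 1) n = a * solCoeff a 1 m n := by
  rw [solCoeff_eq_sum_range a 0 (N := m + 2) (by omega),
    solCoeff_eq_sum_range a 1 (N := m + 1) (by omega), mul_sum, mul_sum]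
  have hL : ∀ p, ((m : R) + 1) * (risingCoeff (a + 0) p * coeff (m + 1) (expSeries a p) *
      coeff n (expSeries 0 p)) = (a + p) * risingCoeff a p * coeff m (expSeries a p) *
        coeff n (expSeries 0 p) +
      p * risingCoeff a p * coeff m (expSeries a (p - 1)) * coeff n (expSeries 0 p) := by
    intro p
    rw [add_zero]
    linear_combination risingCoeff a p * coeff n (expSeries 0 p) *
      succ_mul_coeff_succ_expSeries a p m
  have hR : ∀ p, a * (risingCoeff (a + 1) p * coeff m (expSeries a p) *
      coeff n (expSeries 1 p)) = (a + p) * risingCoeff a p * coeff m (expSeries a p) *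
        coeff n (expSeries 0 p) +
      ((p : R) + 1) * risingCoeff a (p + 1) * coeff m (expSeries a p) *
        coeff n (expSeries 0 (p + 1)) := by
    intro p
    have h := congrArg (coeff n) (expSeries_add_one (0 : R) p)
    rw [zero_add, map_add] at h
    rw [h, succ_mul_risingCoeff_succ]
    linear_combination (coeff m (expSeries a p) *
      (coeff n (expSeries 0 p) + coeff n (expSeries 0 (p + 1)))) * mul_risingCoeff_add_one a p
  simp_rw [hL, hR]
  -- The surplus terms on the left vanish: the one at p = m + 1 in the first sum for degree reasons,
  -- the one at p = 0 in the second through its factor p.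
  rw [sum_add_distrib, sum_add_distrib, sum_range_succ, sum_range_succ' _ (m + 1),
    coeff_expSeries_of_lt a (Nat.lt_succ_self m)]
  simp

/-- The coefficient form of F_{a,b} = F_{a,0} F_{0,b}: the powers of index k and l multiply to one
of index k + l, and Vandermonde's identity sums the rising factorials over k + l = p. -/
theorem solCoeff_eq_sum_antidiagonal (a b : R) (m n : ℕ) :
    solCoeff a b m n = ∑ x ∈ antidiagonal m, ∑ y ∈ antidiagonal n,
      solCoeff a 0 x.1 y.1 * solCoeff 0 b x.2 y.2 := by
  have h1 : ∀ x ∈ antidiagonal m, ∀ y ∈ antidiagonal n,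
      solCoeff a 0 x.1 y.1 * solCoeff 0 b x.2 y.2 =
      ∑ k ∈ range (m + 1) ×ˢ range (m + 1), risingCoeff a k.1 * risingCoeff b k.2 *
        ((coeff x.1 (expSeries a k.1) * coeff x.2 (expSeries 0 k.2)) *
         (coeff y.1 (expSeries 0 k.1) * coeff y.2 (expSeries b k.2))) := by
    intro x hx y _
    have hx := mem_antidiagonal.1 hx
    rw [solCoeff_eq_sum_range a 0 (N := m + 1) (by omega),
      solCoeff_eq_sum_range 0 b (N := m + 1) (by omega), sum_mul_sum, sum_product]
    refine sum_congr rfl fun k _ => sum_congr rfl fun l _ => ?_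
    rw [add_zero, zero_add]
    ring
  have h2 : ∑ x ∈ antidiagonal m, ∑ y ∈ antidiagonal n,
      solCoeff a 0 x.1 y.1 * solCoeff 0 b x.2 y.2 =
      ∑ k ∈ range (m + 1) ×ˢ range (m + 1), risingCoeff a k.1 * risingCoeff b k.2 *
        (coeff m (expSeries a (k.1 + k.2)) * coeff n (expSeries b (k.1 + k.2))) := by
    rw [sum_congr rfl fun x hx => sum_congr rfl (h1 x hx)]
    simp_rw [sum_comm (t := range (m + 1) ×ˢ range (m + 1))]
    refine sum_congr rfl fun k _ => ?_
    have ha := congrArg (coeff m) (expSeries_mul a 0 k.1 k.2)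
    have hb := congrArg (coeff n) (expSeries_mul 0 b k.1 k.2)
    rw [add_zero, coeff_mul] at ha
    rw [zero_add, coeff_mul] at hb
    rw [← ha, ← hb, sum_mul_sum, mul_sum]
    exact sum_congr rfl fun x _ => (mul_sum _ _ _).symm
  -- The square is reindexed by the diagonals k + l = p ≤ m; pairs with k + l > m contribute zero.
  have h3 : ∑ k ∈ range (m + 1) ×ˢ range (m + 1), risingCoeff a k.1 * risingCoeff b k.2 *
        (coeff m (expSeries a (k.1 + k.2)) * coeff n (expSeries b (k.1 + k.2))) =
      ∑ k ∈ (range (m + 1)).sigma antidiagonal, risingCoeff a k.2.1 * risingCoeff b k.2.2 *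
        (coeff m (expSeries a (k.2.1 + k.2.2)) * coeff n (expSeries b (k.2.1 + k.2.2))) := by
    symm
    refine sum_of_injOn (fun k => k.2) ?_ ?_ ?_ (fun _ _ => rfl)
    · rintro ⟨p, x⟩ hp ⟨q, y⟩ hq h
      simp only [coe_sigma, Set.mem_sigma_iff, mem_coe, HasAntidiagonal.mem_antidiagonal] at hp hq h
      subst h
      obtain rfl : p = q := by rw [← hp.2, ← hq.2]
      rfl
    · rintro ⟨p, x⟩ hp
      simp only [coe_sigma, Set.mem_sigma_iff, mem_coe, HasAntidiagonal.mem_antidiagonal, mem_range] at hp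
      simp only [coe_product, Set.mem_prod, mem_coe, mem_range]
      omega
    · rintro k - hk
      have : m < k.1 + k.2 := by
        by_contra hlt
        exact hk ⟨⟨k.1 + k.2, k⟩, by simp; omega, rfl⟩
      rw [coeff_expSeries_of_lt a this]
      ring
  rw [h2, h3, sum_sigma, solCoeff]
  refine sum_congr rfl fun p _ => ?_
  rw [← sum_antidiagonal_risingCoeff, sum_mul, sum_mul]
  refine sum_congr rfl fun x hx => ?_
  rw [mem_antidiagonal.1 hx]
  ring

/-- The coefficients in terms of `q`-Stirling numbers. -/
theorem factorial_mul_factorial_mul_solCoeff (a b : R) (m n : ℕ) :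
    (m ! : R) * n ! * solCoeff a b m n = ∑ p ∈ range (m + 1),
      (p ! : R) * risingFactorial (a + b) p * qStirling a (m + 1) (p + 1) *
        qStirling b (n + 1) (p + 1) := by
  rw [solCoeff, mul_sum]
  refine sum_congr rfl fun p _ => ?_
  rw [← factorial_mul_risingCoeff]
  linear_combination
    - risingCoeff (a + b) p * (p ! * qStirling b (n + 1) (p + 1)) * factorial_mul_qStirling a m p
    - risingCoeff (a + b) p * (m ! * coeff m (expSeries a p)) * factorial_mul_qStirling b n p

end Algebra
end NATree
end

noncomputable section

namespace NATree

/-! ### Counting decreasing labellings -/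

section Labellings

/-- The bijective labellings of `V` by `L` that decrease along `r`. -/
abbrev DecLabelling {V : Type*} (r : V → V → Prop) (L : Type*) [LT L] :=
  {e : V ≃ L // ∀ u v, r u v → e v < e u}

/-- The number of decreasing labellings by an initial segment of the integers. -/
def numDec {V : Type*} (r : V → V → Prop) : ℕ := Nat.card (DecLabelling r (Fin (Nat.card V)))

/-- Only the order type of the labels matters, so arbitrary subsets of labels can be used when
labellings are split. -/
theorem card_decLabelling {V L : Type*} (r : V → V → Prop) [LinearOrder L] [Finite L]
    (h : Nat.card L = Nat.card V) : Nat.card (DecLabelling r L) = numDec r := by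
  have := Fintype.ofFinite L
  rw [Nat.card_eq_fintype_card] at h
  let o := Fintype.orderIsoFinOfCardEq L h
  refine Nat.card_congr (Equiv.subtypeEquiv (Equiv.equivCongr (Equiv.refl V) o.symm.toEquiv) ?_)
  intro e
  simp [Equiv.equivCongr]

theorem isEmpty_decLabelling {V L : Type*} (r : V → V → Prop) [LT L]
    (h : Nat.card L ≠ Nat.card V) : IsEmpty (DecLabelling r L) :=
  ⟨fun e => h (Nat.card_congr e.1).symm⟩

theorem numDec_congr {V W : Type*} {r : V → V → Prop} {s : W → W → Prop} (f : r ≃r s) :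
    numDec r = numDec s := by
  unfold numDec
  rw [← Nat.card_congr f.toEquiv]
  refine Nat.card_congr (Equiv.subtypeEquiv (Equiv.equivCongr f.toEquiv (Equiv.refl _)) ?_)
  intro e
  constructor
  · intro h u v huv
    exact h _ _ (f.symm.map_rel_iff.2 huv)
  · intro h u v huv
    have := h (f u) (f v) (f.map_rel_iff.2 huv)
    change e (f.toEquiv.symm (f.toEquiv v)) < e (f.toEquiv.symm (f.toEquiv u)) at this
    rwa [Equiv.symm_apply_apply, Equiv.symm_apply_apply] at this

theorem numDec_of_isEmpty {V : Type*} [IsEmpty V] (r : V → V → Prop) : numDec r = 1 := by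
  unfold numDec
  have : IsEmpty (Fin (Nat.card V)) := by
    rw [Nat.card_of_isEmpty]; infer_instance
  rw [Nat.card_eq_one_iff_unique]
  exact ⟨inferInstance, ⟨⟨Equiv.equivOfIsEmpty _ _, fun u => isEmptyElim u⟩⟩⟩

/-- Labellings of a disjoint union by `L`, from the set of labels of the first summand. -/
def DecLabelling.glue {V W L : Type*} (r : V → V → Prop) (s : W → W → Prop) [LinearOrder L]
    (x : Σ S : Finset L, DecLabelling r S × DecLabelling s {a // a ∉ S}) :
    DecLabelling (Sum.LiftRel r s) L :=
  ⟨(Equiv.sumCongr x.2.1.1 x.2.2.1).trans (Equiv.sumCompl (· ∈ x.1)), by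
    rintro _ _ (h | h)
    · simpa using x.2.1.2 _ _ h
    · simpa using x.2.2.2 _ _ h⟩

/-- A labelling of the union recovers the set `S` as the image of the first summand, and the two
labellings as its restrictions. -/
theorem DecLabelling.glue_bijective {V W L : Type*} (r : V → V → Prop) (s : W → W → Prop)
    [LinearOrder L] [Finite V] : Function.Bijective (DecLabelling.glue (L := L) r s) := by
  constructor
  · rintro ⟨S, e, f⟩ ⟨S', e', f'⟩ h
    have hl : ∀ v, (e.1 v : L) = e'.1 v := fun v => by
      simpa [DecLabelling.glue] using congrArg (fun g => g.1 (Sum.inl v)) h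
    have hr : ∀ v, (f.1 v : L) = f'.1 v := fun v => by
      simpa [DecLabelling.glue] using congrArg (fun g => g.1 (Sum.inr v)) h
    have hS : S = S' := by
      ext a
      constructor
      · intro ha
        have := hl (e.1.symm ⟨a, ha⟩)
        rw [Equiv.apply_symm_apply] at this
        exact (show a = _ from this) ▸ (e'.1 _).2
      · intro ha
        have := hl (e'.1.symm ⟨a, ha⟩)
        rw [Equiv.apply_symm_apply] at this
        exact (show _ = a from this) ▸ (e.1 _).2
    subst hS
    have he : e = e' := Subtype.ext (Equiv.ext fun v => Subtype.ext (hl v))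
    have hf : f = f' := Subtype.ext (Equiv.ext fun v => Subtype.ext (hr v))
    rw [he, hf]
  · rintro ⟨g, hg⟩
    have := Fintype.ofFinite V
    let S : Finset L := Finset.univ.image fun v : V => g (Sum.inl v)
    have hmem : ∀ a, a ∈ S ↔ ∃ v, g (Sum.inl v) = a := by simp [S]
    let e : V ≃ S := Equiv.ofBijective (fun v => ⟨g (Sum.inl v), (hmem _).2 ⟨v, rfl⟩⟩) <| by
      constructor
      · intro u v h
        simpa using h
      · rintro ⟨a, ha⟩
        obtain ⟨v, hv⟩ := (hmem a).1 ha
        exact ⟨v, Subtype.ext hv⟩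
    let f : W ≃ {a // a ∉ S} := Equiv.ofBijective
      (fun w => ⟨g (Sum.inr w), fun h => by obtain ⟨v, hv⟩ := (hmem _).1 h; simp at hv⟩) <| by
      constructor
      · intro u v h
        simpa using h
      · rintro ⟨a, ha⟩
        rcases h : g.symm a with v | w
        · exact absurd ((hmem a).2 ⟨v, by rw [← h, Equiv.apply_symm_apply]⟩) ha
        · exact ⟨w, Subtype.ext (by simp [← h])⟩
    refine ⟨⟨S, ⟨e, fun u v h => ?_⟩, ⟨f, fun u v h => ?_⟩⟩, ?_⟩
    · exact hg _ _ (Sum.LiftRel.inl h)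
    · exact hg _ _ (Sum.LiftRel.inr h)
    · refine Subtype.ext (Equiv.ext ?_)
      rintro (v | w) <;> simp only [DecLabelling.glue, Equiv.trans_apply, Equiv.sumCongr_apply,
        Sum.map_inl, Sum.map_inr, Equiv.sumCompl_apply_inl, Equiv.sumCompl_apply_inr] <;> rfl

/-- No relation links the two summands, so the label set of the first is any subset of the right
size; this choice gives the binomial coefficient. -/
theorem numDec_sum {V W : Type*} [Finite V] [Finite W] (r : V → V → Prop) (s : W → W → Prop) :
    numDec (Sum.LiftRel r s) =
      (Nat.card V + Nat.card W).choose (Nat.card V) * (numDec r * numDec s) := by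
  rw [numDec, Nat.card_sum, ← Nat.card_eq_of_bijective _ (DecLabelling.glue_bijective r s),
    Nat.card_sigma]
  have key : ∀ S : Finset (Fin (Nat.card V + Nat.card W)),
      Nat.card (DecLabelling r S × DecLabelling s {a // a ∉ S}) =
        if S.card = Nat.card V then numDec r * numDec s else 0 := by
    intro S
    rw [Nat.card_prod]
    split_ifs with h
    · rw [card_decLabelling r (by simpa using h), card_decLabelling s]
      have := Fintype.card_subtype_compl (· ∈ S)
      rw [Nat.card_eq_fintype_card, this]
      simp [h]
    · have := isEmpty_decLabelling r (L := S) (by simpa using h)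
      simp
  simp_rw [key]
  rw [← Finset.sum_filter, Finset.sum_const, smul_eq_mul]
  congr 1
  have := Finset.card_powersetCard (Nat.card V)
    (Finset.univ : Finset (Fin (Nat.card V + Nat.card W)))
  rw [Finset.card_univ, Fintype.card_fin] at this
  rw [← this]
  congr 1
  ext S
  simp

/-- The relation `r` on `V` with a new element above all others. -/
def withTopRel {V : Type*} (r : V → V → Prop) : Option V → Option V → Prop
  | none, some _ => True
  | some u, some v => r u v
  | _, none => False

/-- The top element is forced to take the largest label, and the rest is a decreasing labelling by
the remaining labels. -/
theorem numDec_withTopRel {V : Type*} [Finite V] (r : V → V → Prop) :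
    numDec (withTopRel r) = numDec r := by
  have hc : Nat.card (Option V) = Nat.card V + 1 := Finite.card_option
  rw [numDec, hc]
  have hlast : ∀ e : DecLabelling (withTopRel r) (Fin (Nat.card V + 1)),
      e.1 none = Fin.last _ := by
    intro e
    refine Fin.last_le_iff.1 ?_
    obtain ⟨x, hx⟩ := e.1.surjective (Fin.last _)
    rcases x with _ | v
    · exact hx.ge
    · rw [← hx]
      exact (e.2 none (some v) trivial).le
  rw [← card_decLabelling (L := {y : Fin (Nat.card V + 1) // y ≠ Fin.last _}) r (by simp)]
  let F := Equiv.optionSubtype (α := V) (Fin.last (Nat.card V))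
  refine Nat.card_congr
    { toFun := fun e => ⟨F ⟨e.1, hlast e⟩, fun u v h => e.2 (some u) (some v) h⟩
      invFun := fun e => ⟨(F.symm e.1).1, ?_⟩
      left_inv := fun e => ?_
      right_inv := fun e => ?_ }
  · rintro (_ | u) (_ | v) h
    · exact h.elim
    · rw [(F.symm e.1).2]
      exact lt_of_le_of_ne (Fin.le_last _) (by simp [F, (e.1 v).2])
    · exact h.elim
    · simpa [F] using e.2 u v h
  · simp [F]
  · simp [F]

end Labellings
end NATree
end

noncomputable section

namespace NATree

open Finset

/-! ### Decomposition of binary trees at the root -/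

section Trees

/-- The vertices that are reached by a last step `b`. -/
def stepVertices (b : Bool) (B : BinaryTree Unit) : Finset (List Bool) :=
  (vertices B).filter (fun v => v.getLast? = some b)

/-- The vertices that are reached by a last step `b` once the root is itself attached by such a
step. -/
def plantedVertices (b : Bool) (B : BinaryTree Unit) : Finset (List Bool) :=
  (vertices B).filter (fun v => v = [] ∨ v.getLast? = some b)

/-- The root and everything reached from it by steps `b` only. -/
def branch (b : Bool) (B : BinaryTree Unit) : Finset (List Bool) :=
  (vertices B).filter (fun v => ∀ s ∈ v, s = b)

/-- Strict ancestry in a set of vertices. -/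
def ancestorRel (S : Finset (List Bool)) (U V : S) : Prop :=
  U ≠ V ∧ (U : List Bool) <+: (V : List Bool)

theorem nil_mem_vertices_node (u : Unit) (l r : BinaryTree Unit) :
    [] ∈ vertices (.node u l r) := by
  simp [vertices]

theorem nil_mem_vertices {B : BinaryTree Unit} (h : B ≠ .nil) : [] ∈ vertices B := by
  cases B with
  | nil => exact absurd rfl h
  | node u l r => exact nil_mem_vertices_node u l r

theorem cons_mem_vertices_node (u : Unit) (l r : BinaryTree Unit) (c : Bool) (v : List Bool) :
    c :: v ∈ vertices (.node u l r) ↔ v ∈ vertices (cond c r l) := by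
  cases c <;> simp [vertices]

theorem getLast?_cons_self (b : Bool) (v : List Bool) :
    (b :: v).getLast? = some b ↔ v = [] ∨ v.getLast? = some b := by
  cases v <;> simp [List.getLast?_cons_cons]

theorem getLast?_not_cons (b : Bool) (v : List Bool) :
    ((!b) :: v).getLast? = some b ↔ v.getLast? = some b := by
  cases v <;> simp [List.getLast?_cons_cons]

theorem cons_mem_stepVertices (b : Bool) (u : Unit) (l r : BinaryTree Unit) (v : List Bool) :
    b :: v ∈ stepVertices b (.node u l r) ↔ v ∈ plantedVertices b (cond b r l) := by
  simp [stepVertices, plantedVertices, cons_mem_vertices_node, getLast?_cons_self]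

theorem not_cons_mem_stepVertices (b : Bool) (u : Unit) (l r : BinaryTree Unit) (v : List Bool) :
    (!b) :: v ∈ stepVertices b (.node u l r) ↔ v ∈ stepVertices b (cond (!b) r l) := by
  simp [stepVertices, cons_mem_vertices_node, getLast?_not_cons]

theorem mem_plantedVertices {b : Bool} {B : BinaryTree Unit} (h : B ≠ .nil) (v : List Bool) :
    v ∈ plantedVertices b B ↔ v = [] ∨ v ∈ stepVertices b B := by
  simp only [plantedVertices, stepVertices, mem_filter]
  constructor
  · rintro ⟨h1, h2 | h2⟩
    · exact Or.inl h2
    · exact Or.inr ⟨h1, h2⟩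
  · rintro (rfl | ⟨h1, h2⟩)
    · exact ⟨nil_mem_vertices h, Or.inl rfl⟩
    · exact ⟨h1, Or.inr h2⟩

theorem nil_notMem_stepVertices (b : Bool) (B : BinaryTree Unit) : [] ∉ stepVertices b B := by
  simp [stepVertices]

/-- The step vertices of a tree, from those of its two subtrees. -/
def stepVerticesNodeEquiv (b : Bool) (u : Unit) (l r : BinaryTree Unit) :
    Sum.LiftRel (ancestorRel (plantedVertices b (cond b r l)))
      (ancestorRel (stepVertices b (cond (!b) r l))) ≃r
    ancestorRel (stepVertices b (.node u l r)) where
  toEquiv := Equiv.ofBijective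
    (Sum.elim (fun v => ⟨b :: v.1, (cons_mem_stepVertices b u l r v).2 v.2⟩)
      (fun v => ⟨(!b) :: v.1, (not_cons_mem_stepVertices b u l r v).2 v.2⟩)) <| by
    constructor
    · rintro (⟨v, hv⟩ | ⟨v, hv⟩) (⟨w, hw⟩ | ⟨w, hw⟩) h <;> simp_all
    · rintro ⟨v, hv⟩
      cases v with
      | nil => exact absurd hv (nil_notMem_stepVertices _ _)
      | cons c v =>
        by_cases hc : c = b
        · subst hc
          exact ⟨Sum.inl ⟨v, (cons_mem_stepVertices c u l r v).1 hv⟩, rfl⟩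
        · obtain rfl : c = !b := by cases c <;> cases b <;> simp_all
          exact ⟨Sum.inr ⟨v, (not_cons_mem_stepVertices b u l r v).1 hv⟩, rfl⟩
  map_rel_iff' := by
    rintro (⟨v, hv⟩ | ⟨v, hv⟩) (⟨w, hw⟩ | ⟨w, hw⟩) <;>
      simp [ancestorRel, Equiv.ofBijective, List.cons_prefix_cons]

/-- The root lies above all other planted vertices. -/
def plantedVerticesEquiv (b : Bool) {B : BinaryTree Unit} (h : B ≠ .nil) :
    withTopRel (ancestorRel (stepVertices b B)) ≃r ancestorRel (plantedVertices b B) where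
  toEquiv := Equiv.ofBijective
    (fun x => x.elim ⟨[], (mem_plantedVertices h _).2 (Or.inl rfl)⟩
      (fun v => ⟨v.1, (mem_plantedVertices h _).2 (Or.inr v.2)⟩)) <| by
    have h0 := nil_notMem_stepVertices b B
    constructor
    · rintro (_ | ⟨v, hv⟩) (_ | ⟨w, hw⟩) h <;> simp at h ⊢
      · exact h0 (h ▸ hw)
      · exact h0 (h ▸ hv)
      · exact h
    · rintro ⟨v, hv⟩
      rcases (mem_plantedVertices h _).1 hv with rfl | hv'
      · exact ⟨none, rfl⟩
      · exact ⟨some ⟨v, hv'⟩, rfl⟩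
  map_rel_iff' := by
    have h0 := nil_notMem_stepVertices b B
    rintro (_ | ⟨v, hv⟩) (_ | ⟨w, hw⟩)
    · simp [ancestorRel, withTopRel]
    · simp only [ancestorRel, withTopRel, iff_true]
      refine ⟨fun h => ?_, List.nil_prefix⟩
      have : ([] : List Bool) = w := congrArg Subtype.val h
      exact h0 (this ▸ hw)
    · simp only [ancestorRel, withTopRel, iff_false]
      rintro ⟨-, h⟩
      exact h0 (List.prefix_nil.1 h ▸ hv)
    · simp [ancestorRel, withTopRel, Equiv.ofBijective]

/-! ### Vertex counts and proportions of decreasing labellings -/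

theorem card_stepVertices_nil (b : Bool) : #(stepVertices b .nil) = 0 := by
  simp [stepVertices, vertices]

theorem card_plantedVertices_nil (b : Bool) : #(plantedVertices b .nil) = 0 := by
  simp [plantedVertices, vertices]

theorem card_stepVertices_node (b : Bool) (u : Unit) (l r : BinaryTree Unit) :
    #(stepVertices b (.node u l r)) =
      #(plantedVertices b (cond b r l)) + #(stepVertices b (cond (!b) r l)) := by
  have := Nat.card_congr (stepVerticesNodeEquiv b u l r).toEquiv
  rw [Nat.card_sum] at this
  simpa using this.symm

theorem card_plantedVertices (b : Bool) {B : BinaryTree Unit} (h : B ≠ .nil) :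
    #(plantedVertices b B) = #(stepVertices b B) + 1 := by
  have := Nat.card_congr (plantedVerticesEquiv b h).toEquiv
  rw [Finite.card_option] at this
  simpa using this.symm

theorem card_branch_nil (b : Bool) : #(branch b .nil) = 0 := by
  simp [branch, vertices]

theorem card_branch (b : Bool) {B : BinaryTree Unit} (h : B ≠ .nil) :
    #(branch b B) = #((branch b B).erase []) + 1 := by
  refine (card_erase_add_one ?_).symm
  simp [branch, nil_mem_vertices h]

theorem card_branch_node_erase (b : Bool) (u : Unit) (l r : BinaryTree Unit) :
    #((branch b (.node u l r)).erase []) = #(branch b (cond b r l)) := by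
  rw [← card_image_of_injective (branch b (cond b r l)) (List.cons_injective (a := b))]
  congr 1
  ext v
  cases v with
  | nil => simp
  | cons c v =>
    simp only [branch, mem_erase, mem_filter, cons_mem_vertices_node, mem_image, List.mem_cons,
      forall_eq_or_imp, List.cons.injEq]
    constructor
    · rintro ⟨-, h1, rfl, h2⟩
      exact ⟨v, ⟨h1, h2⟩, rfl, rfl⟩
    · rintro ⟨w, ⟨h1, h2⟩, rfl, rfl⟩
      exact ⟨by simp, h1, rfl, h2⟩

/-- The proportion of decreasing labellings among all labellings. -/
def labProportion (S : Finset (List Bool)) : ℚ := numDec (ancestorRel S) / (#S)!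

theorem labProportion_of_card_eq_zero {S : Finset (List Bool)} (h : #S = 0) :
    labProportion S = 1 := by
  obtain rfl := card_eq_zero.1 h
  simp [labProportion, numDec_of_isEmpty]

/-- Dividing by the factorial cancels the binomial coefficient of `numDec_sum`, so the proportion is
multiplicative over the two subtrees. -/
theorem labProportion_stepVertices_node (b : Bool) (u : Unit) (l r : BinaryTree Unit) :
    labProportion (stepVertices b (.node u l r)) =
      labProportion (plantedVertices b (cond b r l)) *
        labProportion (stepVertices b (cond (!b) r l)) := by
  simp only [labProportion]
  rw [← numDec_congr (stepVerticesNodeEquiv b u l r), numDec_sum, card_stepVertices_node]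
  simp only [Nat.card_eq_fintype_card, Fintype.card_coe]
  have h := Nat.add_choose_mul_factorial_mul_factorial (#(plantedVertices b (cond b r l)))
    (#(stepVertices b (cond (!b) r l)))
  rw [← Nat.choose_symm_add] at h
  rw [← h]
  have hc := (Nat.choose_pos (Nat.le_add_right (#(plantedVertices b (cond b r l)))
    (#(stepVertices b (cond (!b) r l))))).ne'
  push_cast
  field_simp

/-- Planting adds a top vertex: the number of decreasing labellings is unchanged while the factorial
gains one factor. This factor becomes the derivative in the functional equation. -/
theorem labProportion_plantedVertices (b : Bool) {B : BinaryTree Unit} (h : B ≠ .nil) :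
    ((#(stepVertices b B) : ℚ) + 1) * labProportion (plantedVertices b B) =
      labProportion (stepVertices b B) := by
  simp only [labProportion]
  rw [← numDec_congr (plantedVerticesEquiv b h), numDec_withTopRel, card_plantedVertices b h,
    Nat.factorial_succ]
  push_cast
  field_simp

/-- Every non-root vertex is either a left or a right child, and the root is counted once, on the
planted side. This confines the trees with given counts to a finite set. -/
theorem numNodes_eq (B : BinaryTree Unit) :
    B.numNodes = #(plantedVertices false B) + #(stepVertices true B) ∧
    B.numNodes = #(stepVertices false B) + #(plantedVertices true B) := by
  induction B with
  | nil => simp [card_plantedVertices_nil, card_stepVertices_nil, BinaryTree.numNodes]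
  | node u l r hl hr =>
    have h : BinaryTree.node u l r ≠ .nil := by simp
    rw [card_plantedVertices _ h, card_plantedVertices _ h, card_stepVertices_node,
      card_stepVertices_node, BinaryTree.numNodes]
    simp only [cond_true, cond_false, Bool.not_true, Bool.not_false]
    omega

theorem plantedVertices_card_eq_zero {b : Bool} {B : BinaryTree Unit} :
    #(plantedVertices b B) = 0 ↔ B = .nil := by
  constructor
  · intro h
    by_contra hB
    rw [card_plantedVertices b hB] at h
    omega
  · rintro rfl
    exact card_plantedVertices_nil b

/-- The non-empty trees with `m` left children and `n` right children. -/
def shapes (m n : ℕ) : Finset (BinaryTree Unit) :=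
  {B ∈ BinaryTree.treesOfNumNodesEq (m + n + 1) |
    #(stepVertices false B) = m ∧ #(stepVertices true B) = n}

/-- The trees that contribute `m` left children and `n` right children as a left subtree. -/
def leftSubtrees (m n : ℕ) : Finset (BinaryTree Unit) :=
  {B ∈ BinaryTree.treesOfNumNodesEq (m + n) |
    #(plantedVertices false B) = m ∧ #(stepVertices true B) = n}

/-- The trees that contribute `m` left children and `n` right children as a right subtree. -/
def rightSubtrees (m n : ℕ) : Finset (BinaryTree Unit) :=
  {B ∈ BinaryTree.treesOfNumNodesEq (m + n) |
    #(stepVertices false B) = m ∧ #(plantedVertices true B) = n}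

theorem mem_shapes {m n : ℕ} {B : BinaryTree Unit} : B ∈ shapes m n ↔
    B ≠ .nil ∧ #(stepVertices false B) = m ∧ #(stepVertices true B) = n := by
  rw [shapes, mem_filter, BinaryTree.mem_treesOfNumNodesEq]
  have h1 := (numNodes_eq B).1
  constructor
  · rintro ⟨h, h2⟩
    refine ⟨?_, h2⟩
    rintro rfl
    simp [BinaryTree.numNodes] at h
  · rintro ⟨h, h2⟩
    rw [card_plantedVertices _ h] at h1
    exact ⟨by omega, h2⟩

theorem mem_leftSubtrees {m n : ℕ} {B : BinaryTree Unit} : B ∈ leftSubtrees m n ↔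
    #(plantedVertices false B) = m ∧ #(stepVertices true B) = n := by
  rw [leftSubtrees, mem_filter, BinaryTree.mem_treesOfNumNodesEq, (numNodes_eq B).1]
  omega

theorem mem_rightSubtrees {m n : ℕ} {B : BinaryTree Unit} : B ∈ rightSubtrees m n ↔
    #(stepVertices false B) = m ∧ #(plantedVertices true B) = n := by
  rw [rightSubtrees, mem_filter, BinaryTree.mem_treesOfNumNodesEq, (numNodes_eq B).2]
  omega

/-! ### Weighted sums over shapes and their recursion -/

variable {R : Type*} [CommRing R] [Algebra ℚ R]

/-- The weight of a shape. -/
def shapeWeight (α β : R) (B : BinaryTree Unit) : R :=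
  α ^ #((branch false B).erase []) * β ^ #((branch true B).erase []) *
    algebraMap ℚ R (labProportion (stepVertices false B) * labProportion (stepVertices true B))

/-- The contribution of a left subtree to the weight. -/
def leftWeight (α : R) (B : BinaryTree Unit) : R :=
  α ^ #(branch false B) * algebraMap ℚ R
    (labProportion (plantedVertices false B) * labProportion (stepVertices true B))

/-- The contribution of a right subtree to the weight. -/
def rightWeight (β : R) (B : BinaryTree Unit) : R :=
  β ^ #(branch true B) * algebraMap ℚ R
    (labProportion (stepVertices false B) * labProportion (plantedVertices true B))

theorem shapeWeight_node (α β : R) (u : Unit) (l r : BinaryTree Unit) :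
    shapeWeight α β (.node u l r) = leftWeight α l * rightWeight β r := by
  simp only [shapeWeight, leftWeight, rightWeight, labProportion_stepVertices_node,
    card_branch_node_erase, cond_true, cond_false, Bool.not_true, Bool.not_false, map_mul]
  ring

/-- The root of the left subtree adds one vertex to the leftmost branch, whence the factor `α`.
Right steps inside this subtree do not count towards the rightmost branch, whence the parameter `1`.
-/
theorem mul_leftWeight (α : R) {B : BinaryTree Unit} (h : B ≠ .nil) :
    ((#(stepVertices false B) : R) + 1) * leftWeight α B = α * shapeWeight α 1 B := by
  have h1 := congrArg (algebraMap ℚ R) (labProportion_plantedVertices false h)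
  rw [map_mul, map_add, map_one, map_natCast] at h1
  simp only [shapeWeight, leftWeight, card_branch _ h, one_pow, map_mul]
  linear_combination (α ^ (#((branch false B).erase []) + 1) *
    algebraMap ℚ R (labProportion (stepVertices true B))) * h1

theorem mul_rightWeight (β : R) {B : BinaryTree Unit} (h : B ≠ .nil) :
    ((#(stepVertices true B) : R) + 1) * rightWeight β B = β * shapeWeight 1 β B := by
  have h1 := congrArg (algebraMap ℚ R) (labProportion_plantedVertices true h)
  rw [map_mul, map_add, map_one, map_natCast] at h1
  simp only [shapeWeight, rightWeight, card_branch _ h, one_pow, map_mul]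
  linear_combination (β ^ (#((branch true B).erase []) + 1) *
    algebraMap ℚ R (labProportion (stepVertices false B))) * h1

/-- The coefficient form of N = L R. The left subtree is planted for left children only and the
right subtree for right children only, since their roots are children of the respective kind. -/
theorem sum_shapes (α β : R) (m n : ℕ) :
    ∑ B ∈ shapes m n, shapeWeight α β B = ∑ x ∈ antidiagonal m, ∑ y ∈ antidiagonal n,
      (∑ l ∈ leftSubtrees x.1 y.1, leftWeight α l) *
        ∑ r ∈ rightSubtrees x.2 y.2, rightWeight β r := by
  simp_rw [sum_mul_sum, ← sum_product']
  rw [sum_sigma']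
  symm
  refine sum_bij (fun z _ => BinaryTree.node () z.2.1 z.2.2) ?_ ?_ ?_ ?_
  · rintro ⟨⟨x, y⟩, l, r⟩ h
    simp only [mem_sigma, mem_product, HasAntidiagonal.mem_antidiagonal, mem_leftSubtrees,
      mem_rightSubtrees] at h
    rw [mem_shapes, card_stepVertices_node, card_stepVertices_node]
    simp only [cond_true, cond_false, Bool.not_true, Bool.not_false]
    refine ⟨by simp, ?_, ?_⟩ <;> omega
  · rintro ⟨⟨⟨x1, x2⟩, ⟨y1, y2⟩⟩, l, r⟩ h ⟨⟨⟨x1', x2'⟩, ⟨y1', y2'⟩⟩, l', r'⟩ h' heq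
    simp only [mem_sigma, mem_product, mem_leftSubtrees, mem_rightSubtrees] at h h'
    simp only [BinaryTree.node.injEq, true_and] at heq
    obtain ⟨rfl, rfl⟩ := heq
    obtain ⟨-, ⟨rfl, rfl⟩, rfl, rfl⟩ := h
    obtain ⟨-, ⟨rfl, rfl⟩, rfl, rfl⟩ := h'
    rfl
  · intro B hB
    rw [mem_shapes] at hB
    cases B with
    | nil => exact absurd rfl hB.1
    | node u l r =>
      rw [card_stepVertices_node, card_stepVertices_node] at hB
      simp only [cond_true, cond_false, Bool.not_true, Bool.not_false] at hB
      refine ⟨⟨((#(plantedVertices false l), #(stepVertices false r)),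
        (#(stepVertices true l), #(plantedVertices true r))), (l, r)⟩, ?_, rfl⟩
      simp only [mem_sigma, mem_product, HasAntidiagonal.mem_antidiagonal, mem_leftSubtrees,
        mem_rightSubtrees, and_self, and_true]
      omega
  · rintro ⟨⟨x, y⟩, l, r⟩ -
    exact (shapeWeight_node α β () l r).symm

theorem sum_leftSubtrees_zero (α : R) (n : ℕ) :
    ∑ B ∈ leftSubtrees 0 n, leftWeight α B = if n = 0 then 1 else 0 := by
  have h : leftSubtrees 0 n = if n = 0 then {.nil} else ∅ := by
    ext B
    rw [mem_leftSubtrees, plantedVertices_card_eq_zero]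
    split_ifs with hn
    · subst hn
      simp only [mem_singleton, and_iff_left_iff_imp]
      rintro rfl
      exact card_stepVertices_nil true
    · simp only [notMem_empty, iff_false]
      rintro ⟨rfl, h⟩
      exact hn (h ▸ card_stepVertices_nil true)
  rw [h]
  split_ifs
  · simp [leftWeight, card_branch_nil, labProportion_of_card_eq_zero, card_plantedVertices_nil,
      card_stepVertices_nil]
  · simp

theorem sum_rightSubtrees_zero (β : R) (m : ℕ) :
    ∑ B ∈ rightSubtrees m 0, rightWeight β B = if m = 0 then 1 else 0 := by
  have h : rightSubtrees m 0 = if m = 0 then {.nil} else ∅ := by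
    ext B
    rw [mem_rightSubtrees, plantedVertices_card_eq_zero]
    split_ifs with hn
    · subst hn
      simp only [mem_singleton, and_iff_right_iff_imp]
      rintro rfl
      exact card_stepVertices_nil false
    · simp only [notMem_empty, iff_false]
      rintro ⟨h, rfl⟩
      exact hn (h ▸ card_stepVertices_nil false)
  rw [h]
  split_ifs
  · simp [rightWeight, card_branch_nil, labProportion_of_card_eq_zero, card_plantedVertices_nil,
      card_stepVertices_nil]
  · simp

theorem leftSubtrees_succ (m n : ℕ) : leftSubtrees (m + 1) n = shapes m n := by
  ext B
  rw [mem_leftSubtrees, mem_shapes]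
  by_cases h : B = .nil
  · subst h
    simp [card_plantedVertices_nil]
  · rw [card_plantedVertices _ h]
    simp [h]

theorem rightSubtrees_succ (m n : ℕ) : rightSubtrees m (n + 1) = shapes m n := by
  ext B
  rw [mem_rightSubtrees, mem_shapes]
  by_cases h : B = .nil
  · subst h
    simp [card_plantedVertices_nil]
  · rw [card_plantedVertices _ h]
    simp [h]

theorem succ_mul_sum_leftSubtrees_succ (α : R) (m n : ℕ) :
    ((m : R) + 1) * ∑ B ∈ leftSubtrees (m + 1) n, leftWeight α B =
      α * ∑ B ∈ shapes m n, shapeWeight α 1 B := by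
  rw [leftSubtrees_succ, mul_sum, mul_sum]
  refine sum_congr rfl fun B hB => ?_
  obtain ⟨h, rfl, -⟩ := mem_shapes.1 hB
  exact mul_leftWeight α h

theorem succ_mul_sum_rightSubtrees_succ (β : R) (m n : ℕ) :
    ((n : R) + 1) * ∑ B ∈ rightSubtrees m (n + 1), rightWeight β B =
      β * ∑ B ∈ shapes m n, shapeWeight 1 β B := by
  rw [rightSubtrees_succ, mul_sum, mul_sum]
  refine sum_congr rfl fun B hB => ?_
  obtain ⟨h, -, rfl⟩ := mem_shapes.1 hB
  exact mul_rightWeight β h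

/-- The total weight of the shapes with `m` left children and `n` right children. -/
theorem sum_shapes_eq_solCoeff (α β : R) (m n : ℕ) :
    ∑ B ∈ shapes m n, shapeWeight α β B = solCoeff α β m n := by
  -- The parameters must vary: the recursion passes from (α, β) to (α, 1) and (1, β). Both sides are
  -- then the same convolution, and are compared factor by factor.
  induction h : m + n using Nat.strong_induction_on generalizing α β m n with
  | _ N ih =>
    rw [sum_shapes, solCoeff_eq_sum_antidiagonal]
    refine sum_congr rfl fun x hx => sum_congr rfl fun y hy => ?_
    rw [HasAntidiagonal.mem_antidiagonal] at hx hy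
    obtain ⟨x1, x2⟩ := x
    obtain ⟨y1, y2⟩ := y
    simp only at hx hy ⊢
    congr 1
    · cases x1 with
      | zero => rw [sum_leftSubtrees_zero, solCoeff_zero_left]
      | succ k =>
        -- The x-derivative of each left factor reduces to a coefficient of degree k + y1 < m + n,
        -- where the induction hypothesis applies.
        apply natCast_succ_mul_cancel k
        rw [succ_mul_sum_leftSubtrees_succ, succ_mul_solCoeff_succ,
          ih (k + y1) (by omega) α 1 k y1 rfl]
    · cases y2 with
      | zero => rw [sum_rightSubtrees_zero, solCoeff_comm, solCoeff_zero_left]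
      | succ k =>
        apply natCast_succ_mul_cancel k
        rw [succ_mul_sum_rightSubtrees_succ, solCoeff_comm, succ_mul_solCoeff_succ,
          ih (x2 + k) (by omega) 1 β x2 k rfl, solCoeff_comm]

end Trees
end NATree
end

noncomputable section

namespace NATree

open Finset

/-! ### From shapes to labelled trees and the generating function -/

section NonAmbiguousTrees

/-- The labellings, as in `NonAmbiguousTree`, of a set of vertices. -/
abbrev VertexLabelling (S : Finset (List Bool)) := DecLabelling (ancestorRel S) (Icc 1 #S)

theorem card_vertexLabelling (S : Finset (List Bool)) :
    Nat.card (VertexLabelling S) = numDec (ancestorRel S) :=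
  card_decLabelling _ (by rw [Nat.card_eq_finsetCard]; simp)

theorem factorial_mul_labProportion (S : Finset (List Bool)) :
    ((#S)! : ℚ) * labProportion S = Nat.card (VertexLabelling S) := by
  rw [card_vertexLabelling, labProportion]
  field_simp

/-- A non-ambiguous tree from its shape and its two labellings. -/
def ofLabellings (x : Σ B : {B : BinaryTree Unit // B ≠ .nil},
    VertexLabelling (stepVertices false B) × VertexLabelling (stepVertices true B)) :
    NonAmbiguousTree where
  shape := x.1
  shape_ne_nil := x.1.2
  leftLabel := x.2.1.1
  rightLabel := x.2.2.1
  leftLabel_lt U V h h' := x.2.1.2 U V ⟨h, h'⟩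
  rightLabel_lt U V h h' := x.2.2.2 U V ⟨h, h'⟩

theorem ofLabellings_bijective : Function.Bijective ofLabellings := by
  refine Function.bijective_iff_has_inverse.2 ⟨fun T => ⟨⟨T.shape, T.shape_ne_nil⟩,
    ⟨T.leftLabel, fun U V h => T.leftLabel_lt U V h.1 h.2⟩,
    ⟨T.rightLabel, fun U V h => T.rightLabel_lt U V h.1 h.2⟩⟩, fun _ => rfl, fun _ => rfl⟩

theorem geomSize_eq_iff (T : NonAmbiguousTree) (m n : ℕ) :
    T.geomSize = (m + 1, n + 1) ↔ T.numLeft = m ∧ T.numRight = n := by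
  simp [NonAmbiguousTree.geomSize]

theorem shape_mem_shapes (T : NonAmbiguousTree) (m n : ℕ) :
    T.shape ∈ shapes m n ↔ T.geomSize = (m + 1, n + 1) := by
  rw [mem_shapes, geomSize_eq_iff]
  exact and_iff_right T.shape_ne_nil

theorem finite_setOf_shape_eq (B : BinaryTree Unit) :
    {T : NonAmbiguousTree | T.shape = B}.Finite := by
  by_cases hB : B = .nil
  · convert Set.finite_empty
    ext T
    simpa [hB] using T.shape_ne_nil
  · refine (Set.finite_range fun x => ofLabellings ⟨⟨B, hB⟩, x⟩).subset ?_
    rintro T rfl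
    obtain ⟨⟨B, x⟩, rfl⟩ := ofLabellings_bijective.2 T
    exact ⟨x, rfl⟩

theorem finite_setOf_geomSize_eq (m n : ℕ) :
    {T : NonAmbiguousTree | T.geomSize = (m + 1, n + 1)}.Finite := by
  refine ((shapes m n).finite_toSet.biUnion fun B _ => finite_setOf_shape_eq B).subset ?_
  intro T hT
  exact Set.mem_biUnion (mem_coe.2 ((shape_mem_shapes T m n).2 hT)) rfl

theorem card_setOf_shape_eq {B : BinaryTree Unit} (hB : B ≠ .nil) :
    Nat.card {T : NonAmbiguousTree | T.shape = B} =
      numDec (ancestorRel (stepVertices false B)) * numDec (ancestorRel (stepVertices true B)) := by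
  rw [← card_vertexLabelling, ← card_vertexLabelling, ← Nat.card_prod]
  symm
  refine Nat.card_eq_of_bijective
    (fun x => (⟨ofLabellings ⟨⟨B, hB⟩, x⟩, rfl⟩ : {T : NonAmbiguousTree | T.shape = B})) ⟨?_, ?_⟩
  · intro x y h
    have := ofLabellings_bijective.1 (congrArg Subtype.val h)
    simpa using this
  · rintro ⟨T, rfl⟩
    obtain ⟨⟨B, x⟩, rfl⟩ := ofLabellings_bijective.2 T
    exact ⟨x, rfl⟩

variable {R : Type*} [CommRing R] [Algebra ℚ R]

/-- The weighted number of non-ambiguous trees of a given size. -/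
theorem weightedCount_eq_solCoeff (α β : R) (m n : ℕ) :
    weightedCount α β (m + 1) (n + 1) = (m ! : R) * n ! * solCoeff α β m n := by
  classical
  have hfin := finite_setOf_geomSize_eq m n
  have h1 : weightedCount α β (m + 1) (n + 1) =
      ∑ T ∈ hfin.toFinset, α ^ T.LO * β ^ T.RO :=
    finsum_mem_eq_finite_toFinset_sum (fun T : NonAmbiguousTree => α ^ T.LO * β ^ T.RO) hfin
  rw [h1, ← sum_fiberwise_of_maps_to (g := NonAmbiguousTree.shape) (t := shapes m n)
    (fun T hT => (shape_mem_shapes T m n).2 (by simpa using hT)),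
    ← sum_shapes_eq_solCoeff, mul_sum]
  refine sum_congr rfl fun B hB => ?_
  obtain ⟨hne, hm, hn⟩ := mem_shapes.1 hB
  -- The weight depends on the shape alone, so each fibre contributes its number of labellings times
  -- a constant.
  have h2 : ∀ T ∈ hfin.toFinset.filter (fun T => T.shape = B), α ^ T.LO * β ^ T.RO =
      α ^ #((branch false B).erase []) * β ^ #((branch true B).erase []) := by
    intro T hT
    obtain rfl := (mem_filter.1 hT).2
    rfl
  have h3 : #(hfin.toFinset.filter (fun T => T.shape = B)) =
      numDec (ancestorRel (stepVertices false B)) *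
        numDec (ancestorRel (stepVertices true B)) := by
    rw [← card_setOf_shape_eq hne, ← Nat.card_eq_finsetCard]
    refine Nat.card_congr (Equiv.subtypeEquivRight fun T => ?_)
    rw [mem_filter, Set.Finite.mem_toFinset]
    refine and_iff_right_of_imp ?_
    rintro rfl
    exact (shape_mem_shapes T m n).1 hB
  rw [sum_congr rfl h2, sum_const, h3, nsmul_eq_mul, shapeWeight]
  have h4 := congrArg (algebraMap ℚ R) (factorial_mul_labProportion (stepVertices false B))
  have h5 := congrArg (algebraMap ℚ R) (factorial_mul_labProportion (stepVertices true B))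
  rw [card_vertexLabelling, map_mul, map_natCast, map_natCast] at h4 h5
  rw [hm] at h4
  rw [hn] at h5
  rw [map_mul, Nat.cast_mul, ← h4, ← h5]
  ring

theorem xyExp_inj {a b c d : ℕ} : xyExp a b = xyExp c d ↔ a = c ∧ b = d := by
  constructor
  · intro h
    have h0 := DFunLike.congr_fun h 0
    have h1 := DFunLike.congr_fun h 1
    simpa [xyExp] using And.intro h0 h1
  · rintro ⟨rfl, rfl⟩
    rfl

/-- Exactly the trees of the given size contribute to this coefficient, all with the same
denominator, which the factorials cancel. -/
theorem factorial_smul_coeff_gf (α β : R) (m n : ℕ) :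
    (m ! * n ! : ℚ) • MvPowerSeries.coeff (xyExp m n) (gf α β) =
      weightedCount α β (m + 1) (n + 1) := by
  classical
  have h1 : MvPowerSeries.coeff (xyExp m n) (gf α β) =
      ∑ᶠ (T : NonAmbiguousTree) (_ : T ∈ {T : NonAmbiguousTree | T.geomSize = (m + 1, n + 1)}),
        ((m ! * n ! : ℚ)⁻¹ • (α ^ T.LO * β ^ T.RO)) := by
    change ∑ᶠ T : NonAmbiguousTree, MvPowerSeries.coeff (xyExp m n) (gfTerm α β T) = _
    refine finsum_congr fun T => ?_
    rw [gfTerm, MvPowerSeries.coeff_monomial, Set.mem_ofPred_eq, geomSize_eq_iff]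
    by_cases h : T.numLeft = m ∧ T.numRight = n
    · obtain ⟨rfl, rfl⟩ := h
      simp
    · have h' : ¬ xyExp m n = xyExp T.numLeft T.numRight := fun h' =>
        h ((xyExp_inj.1 h').imp Eq.symm Eq.symm)
      rw [if_neg h']
      simp [h]
  have hfin := finite_setOf_geomSize_eq m n
  rw [h1, finsum_mem_eq_finite_toFinset_sum _ hfin, smul_sum]
  refine (sum_congr rfl fun T _ => ?_).trans
    (finsum_mem_eq_finite_toFinset_sum (fun T : NonAmbiguousTree => α ^ T.LO * β ^ T.RO) hfin).symm
  rw [smul_smul, mul_inv_cancel₀ (by positivity), one_smul]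

/-- Terms with p > m + 1 vanish, so the sum is finite; shifting p by one gives the sum that
`factorial_mul_factorial_mul_solCoeff` evaluates. -/
theorem finsum_qStirling_eq_solCoeff (α β : R) (m n : ℕ) :
    ∑ᶠ (p : ℕ) (_ : 1 ≤ p), ((p - 1)! : R) * risingFactorial (α + β) (p - 1) *
        qStirling α (m + 1) p * qStirling β (n + 1) p = (m ! : R) * n ! * solCoeff α β m n := by
  have h := finsum_mem_eq_sum_of_inter_support_eq (s := {p : ℕ | 1 ≤ p})
    (fun p : ℕ => ((p - 1)! : R) * risingFactorial (α + β) (p - 1) *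
        qStirling α (m + 1) p * qStirling β (n + 1) p) (t := Icc 1 (m + 1)) <| by
    ext p
    simp only [Set.mem_inter_iff, Set.mem_ofPred_eq, coe_Icc, Set.mem_Icc, and_congr_left_iff]
    intro hp
    refine (and_iff_left ?_).symm
    by_contra hlt
    exact hp (by simp [qStirling_eq_zero_of_lt α (not_le.1 hlt)])
  refine h.trans ?_
  rw [factorial_mul_factorial_mul_solCoeff, ← Finset.Ico_succ_right_eq_Icc,
    sum_Ico_eq_sum_range]
  refine sum_congr (by simp) fun p _ => ?_
  rw [Nat.add_comm 1 p, Nat.add_sub_cancel]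

end NonAmbiguousTrees
end NATree
end

theorem mainTheorem2 {R : Type*} [CommRing R] [Algebra ℚ R] (α β : R) (i j : ℕ)
    (hi : 1 ≤ i) (hj : 1 ≤ j) :
    {T : NATree.NonAmbiguousTree | T.geomSize = (i, j)}.Finite ∧
    ((((i - 1)! * (j - 1)! : ℚ)) •
        MvPowerSeries.coeff (NATree.xyExp (i - 1) (j - 1)) (NATree.gf α β) =
      ∑ᶠ (p : ℕ) (_ : 1 ≤ p), ((p - 1)! : R) * NATree.risingFactorial (α + β) (p - 1) *
        NATree.qStirling α i p * NATree.qStirling β j p) ∧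
    (NATree.weightedCount α β i j =
      ∑ᶠ (p : ℕ) (_ : 1 ≤ p), ((p - 1)! : R) * NATree.risingFactorial (α + β) (p - 1) *
        NATree.qStirling α i p * NATree.qStirling β j p) := by
  obtain ⟨m, rfl⟩ := Nat.exists_eq_add_of_le' hi
  obtain ⟨n, rfl⟩ := Nat.exists_eq_add_of_le' hj
  refine ⟨NATree.finite_setOf_geomSize_eq m n, ?_, ?_⟩
  · rw [Nat.add_sub_cancel, Nat.add_sub_cancel, NATree.factorial_smul_coeff_gf,
      NATree.weightedCount_eq_solCoeff, NATree.finsum_qStirling_eq_solCoeff]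
  · rw [NATree.weightedCount_eq_solCoeff, NATree.finsum_qStirling_eq_solCoeff]
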